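/- Let $G=(V,E)$ be a finite connected simple undirected graph with edge weights $w(e)\ge 0$, $e\in E$, and suppose that the edges of positive weight already connect $V$ (this is automatic if all weights are positive). Put $w(\{i,j\})=0$ if $\{i,j\}\notin E$, and let $L\in\mathbb{R}^{V\times V}$ be the Laplacian, $L_{ij}=-w(\{i,j\})$ for $i\ne j$ and $L_{ii}=\sum_{k\neq i} w(\{i,k\})$. The weight of a graph is the product of the weights of its edges (equal to $1$ if there are none), and the weight of a set of graphs is the sum of the weights of its members. Let $\mathcal T$ be the set of spanning trees of $G$ and, for $u,v\in V$, let $\mathcal F_u^v$ be the set of spanning forests of $G$ that consist of exactly two trees and in which $u$ and $v$ are not connected. Let $u,v\in V$ be arbitrary. (a) If $\ell^+_{ij}$ denotes the entries of the Moore--Penrose pseudo-inverse $L^+$ of $L$, then \[ w(\mathcal F_u^v)=w(\mathcal T)\left(\ell^+_{uu}+\ell^+_{vv}-2\ell^+_{uv}\right). \] (b) For $r\in V$ let $L^{[r]}$ be the matrix obtained from $L$ by removing the row and the column of $r$. Then $L^{[r]}$ is invertible for every $r\in V$, and, with $\ell^{-1,[r]}_{ij}$ denoting the entries of its inverse, \[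 w(\mathcal F_u^v)=\begin{cases} w(\mathcal T)\left(\ell^{-1,[r]}_{uu}+\ell^{-1,[r]}_{vv}-2\ell^{-1,[r]}_{uv}\right) & \text{if } r\ne u,v,\\ w(\mathcal T)\,\ell^{-1,[v]}_{uu} & \text{if } r=v \text{ and } u\ne v,\\ w(\mathcal T)\,\ell^{-1,[u]}_{vv} & \text{if } r=u \text{ and } u\neq v.\end{cases} \] -/

import Mathlib

namespace WeightedGraph

open Matrix

/-! ### Moore–Penrose pseudo-inverse of a real matrix -/

/-- `X` satisfies the four Penrose equations for `A`. -/
structure IsPseudoInverse {m n : Type*} [Fintype m] [Fintype n]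
    (A : Matrix m n ℝ) (X : Matrix n m ℝ) : Prop where
  mul_mul_self : A * X * A = A
  mul_mul_inv : X * A * X = X
  symm_left : (A * X)ᵀ = A * X
  symm_right : (X * A)ᵀ = X * A

/-- The Penrose equations have at most one solution. -/
theorem IsPseudoInverse.unique {m n : Type*} [Fintype m] [Fintype n]
    {A : Matrix m n ℝ} {X Y : Matrix n m ℝ}
    (hX : IsPseudoInverse A X) (hY : IsPseudoInverse A Y) : X = Y := by
  have h1 : A * X = A * Y := by
    calc A * X = (A * X)ᵀ := hX.symm_left.symm
      _ = ((A * Y) * (A * X))ᵀ := by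
          rw [← Matrix.mul_assoc (A * Y), hY.mul_mul_self]
      _ = (A * X)ᵀ * (A * Y)ᵀ := Matrix.transpose_mul _ _
      _ = (A * X) * (A * Y) := by rw [hX.symm_left, hY.symm_left]
      _ = A * Y := by rw [← Matrix.mul_assoc, hX.mul_mul_self]
  have h2 : X * A = Y * A := by
    calc X * A = (X * A)ᵀ := hX.symm_right.symm
      _ = ((X * A) * (Y * A))ᵀ := by
          rw [Matrix.mul_assoc X, ← Matrix.mul_assoc A, hY.mul_mul_self]
      _ = (Y * A)ᵀ * (X * A)ᵀ := Matrix.transpose_mul _ _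
      _ = (Y * A) * (X * A) := by rw [hX.symm_right, hY.symm_right]
      _ = Y * A := by rw [Matrix.mul_assoc Y, ← Matrix.mul_assoc A, hX.mul_mul_self]
  calc X = X * A * X := hX.mul_mul_inv.symm
    _ = Y * A * X := by rw [h2]
    _ = Y * (A * X) := Matrix.mul_assoc _ _ _
    _ = Y * (A * Y) := by rw [h1]
    _ = Y * A * Y := (Matrix.mul_assoc _ _ _).symm
    _ = Y := hY.mul_mul_inv

/-- Transposition commutes with taking pseudo-inverses. -/
theorem IsPseudoInverse.transpose {m n : Type*} [Fintype m] [Fintype n]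
    {A : Matrix m n ℝ} {X : Matrix n m ℝ} (h : IsPseudoInverse A X) :
    IsPseudoInverse Aᵀ Xᵀ := by
  refine ⟨?_, ?_, ?_, ?_⟩
  · rw [Matrix.mul_assoc, ← Matrix.transpose_mul, ← Matrix.transpose_mul, h.mul_mul_self]
  · rw [Matrix.mul_assoc, ← Matrix.transpose_mul, ← Matrix.transpose_mul, h.mul_mul_inv]
  · rw [← Matrix.transpose_mul, h.symm_right, h.symm_right]
  · rw [← Matrix.transpose_mul, h.symm_left, h.symm_left]

/-- A real symmetric matrix has a pseudo-inverse. -/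
theorem exists_isPseudoInverse_of_isHermitian {n : Type*} [Fintype n] {A : Matrix n n ℝ}
    (hA : A.IsHermitian) : ∃ X : Matrix n n ℝ, IsPseudoInverse A X := by
  classical
  obtain ⟨U, d, hU, hAU⟩ : ∃ (U : Matrix n n ℝ) (d : n → ℝ),
      Uᵀ * U = 1 ∧ A = U * diagonal d * Uᵀ := by
    refine ⟨hA.eigenvectorUnitary, hA.eigenvalues, ?_, ?_⟩
    · have := Unitary.coe_star_mul_self hA.eigenvectorUnitary
      rwa [Matrix.star_eq_conjTranspose, Matrix.conjTranspose_eq_transpose_of_trivial] at this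
    · have := hA.spectral_theorem
      rw [Unitary.conjStarAlgAut_apply, Matrix.star_eq_conjTranspose,
        Matrix.conjTranspose_eq_transpose_of_trivial] at this
      exact this
  have key : ∀ a b : n → ℝ, (U * diagonal a * Uᵀ) * (U * diagonal b * Uᵀ)
      = U * diagonal (fun i => a i * b i) * Uᵀ := by
    intro a b
    calc (U * diagonal a * Uᵀ) * (U * diagonal b * Uᵀ)
        = U * diagonal a * (Uᵀ * U) * diagonal b * Uᵀ := by simp only [Matrix.mul_assoc]
      _ = U * (diagonal a * diagonal b) * Uᵀ := by
          rw [hU, Matrix.mul_one]; simp only [Matrix.mul_assoc]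
      _ = _ := by rw [Matrix.diagonal_mul_diagonal]
  have hs : ∀ a : n → ℝ, (U * diagonal a * Uᵀ)ᵀ = U * diagonal a * Uᵀ := by
    intro a
    simp [Matrix.transpose_mul, Matrix.mul_assoc]
  refine ⟨U * diagonal (fun i => (d i)⁻¹) * Uᵀ, ?_, ?_, ?_, ?_⟩
  · rw [hAU, key, key]
    simp only [mul_inv_mul_cancel]
  · rw [hAU, key, key]
    have e : (fun i => (d i)⁻¹ * d i * (d i)⁻¹) = fun i => (d i)⁻¹ := by
      funext i
      by_cases h : d i = 0 <;> simp [h]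
    rw [e]
  · rw [hAU, key, hs]
  · rw [hAU, key, hs]

/-- Every real matrix has a pseudo-inverse. -/
theorem exists_isPseudoInverse {m n : Type*} [Fintype m] [Fintype n] (A : Matrix m n ℝ) :
    ∃ X : Matrix n m ℝ, IsPseudoInverse A X := by
  have hB : (Aᵀ * A).IsHermitian := by
    rw [Matrix.IsHermitian, Matrix.conjTranspose_eq_transpose_of_trivial,
      Matrix.transpose_mul, Matrix.transpose_transpose]
  obtain ⟨Y, hY⟩ := exists_isPseudoInverse_of_isHermitian hB
  have hYt : IsPseudoInverse (Aᵀ * A) Yᵀ := by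
    have h := hY.transpose
    rwa [Matrix.transpose_mul, Matrix.transpose_transpose] at h
  have hYs : Yᵀ = Y := hYt.unique hY
  have hz : A * (Y * Aᵀ) * A = A := by
    classical
    have h0 : Aᴴ * A * (Y * Aᵀ * A - 1) = 0 := by
      have := hY.mul_mul_self
      rw [Matrix.conjTranspose_eq_transpose_of_trivial, Matrix.mul_sub, Matrix.mul_one,
        Matrix.mul_assoc Y, ← Matrix.mul_assoc, this, sub_self]
    rw [Matrix.conjTranspose_mul_self_mul_eq_zero, Matrix.mul_sub, Matrix.mul_one,
      sub_eq_zero, ← Matrix.mul_assoc] at h0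
    exact h0
  refine ⟨Y * Aᵀ, hz, ?_, ?_, ?_⟩
  · have := hY.mul_mul_inv
    calc Y * Aᵀ * A * (Y * Aᵀ) = (Y * (Aᵀ * A) * Y) * Aᵀ := by simp only [Matrix.mul_assoc]
      _ = Y * Aᵀ := by rw [this]
  · simp only [Matrix.transpose_mul, Matrix.transpose_transpose, hYs, Matrix.mul_assoc]
  · have := hY.symm_right
    rwa [← Matrix.mul_assoc] at this

/-- The Moore–Penrose pseudo-inverse `A⁺`: the unique solution of the Penrose equations. -/
noncomputable def pseudoInverse {m n : Type*} [Fintype m] [Fintype n]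
    (A : Matrix m n ℝ) : Matrix n m ℝ :=
  (exists_isPseudoInverse A).choose

theorem pseudoInverse_spec {m n : Type*} [Fintype m] [Fintype n] (A : Matrix m n ℝ) :
    IsPseudoInverse A (pseudoInverse A) :=
  (exists_isPseudoInverse A).choose_spec

/-! ### Weighted graphs

A weighted graph is a simple graph `G` with a function `w : Sym2 V → ℝ`;
only the values of `w` on the edges of `G` matter. -/

open Classical in
/-- The weighted Laplacian: `-w {i, j}` off the diagonal and `∑ k, w {i, k}` on the diagonal,
where `w {i, j}` is read as `0` if `{i, j}` is not an edge. -/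
noncomputable def laplacian {V : Type*} [Fintype V] (G : SimpleGraph V) (w : Sym2 V → ℝ) :
    Matrix V V ℝ :=
  Matrix.of fun i j =>
    if i = j then ∑ k, (if G.Adj i k then w s(i, k) else 0)
    else -(if G.Adj i j then w s(i, j) else 0)

/-- The Laplacian with the row and the column of `r` removed. -/
noncomputable def reducedLaplacian {V : Type*} [Fintype V] (G : SimpleGraph V)
    (w : Sym2 V → ℝ) (r : V) : Matrix {x : V // x ≠ r} {x : V // x ≠ r} ℝ :=
  (laplacian G w).submatrix Subtype.val Subtype.val

open Classical in
/-- The weight of a graph: the product of the weights of its edges. -/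
noncomputable def graphWeight {V : Type*} [Fintype V] (w : Sym2 V → ℝ) (H : SimpleGraph V) : ℝ :=
  ∏ e ∈ H.edgeFinset, w e

/-- The weight of a set of graphs: the sum of the weights of its members. -/
noncomputable def familyWeight {V : Type*} [Fintype V] (w : Sym2 V → ℝ)
    (S : Finset (SimpleGraph V)) : ℝ :=
  ∑ H ∈ S, graphWeight w H

open Classical in
/-- The spanning trees of `G` (as subgraphs on the whole vertex set). -/
noncomputable def spanningTrees {V : Type*} [Fintype V] (G : SimpleGraph V) :
    Finset (SimpleGraph V) :=
  {T : SimpleGraph V | T ≤ G ∧ T.IsTree}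

open Classical in
/-- The spanning forests of `G` with exactly two trees that do not connect `u` and `v`. -/
noncomputable def separatingForests {V : Type*} [Fintype V] (G : SimpleGraph V) (u v : V) :
    Finset (SimpleGraph V) :=
  {F : SimpleGraph V | F ≤ G ∧ F.IsAcyclic ∧ Nat.card F.ConnectedComponent = 2 ∧
    ¬ F.Reachable u v}

/-- The spanning subgraph formed by the edges of `G` of positive weight; it is `G` itself
when all edge weights are positive. -/
def positivePart {V : Type*} (G : SimpleGraph V) (w : Sym2 V → ℝ) : SimpleGraph V :=
  SimpleGraph.fromEdgeSet {e | e ∈ G.edgeSet ∧ 0 < w e}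

end WeightedGraph

/-!
Both sides of the matrix-tree theorem satisfy the same deletion recursion: adding an edge `ab` with
`a ∉ R`, `b ∈ R` perturbs a single diagonal entry of the Laplacian with `R` deleted, and removing
`ab` from a forest rooted at `R` splits off a tree rooted at `a`. So the principal minors of the
Laplacian count rooted forests, and Cramer's rule gives the case `r = v`.

For the other cases put `b = e_u - e_v`, which lies in the range of the Laplacian `L`. The number
`bᵀ X b` is then the same for all generalized inverses `X` of `L` (`L X L = L`), and both `L⁺` and
the inverse of `L` with row and column `r` deleted, bordered by zeros, are generalized inverses.
-/

namespace WeightedGraph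

open Matrix

section RootedForests

variable {V : Type*}

theorem reachable_sup_edge_iff {H : SimpleGraph V} {a b x y : V} :
    (H ⊔ SimpleGraph.edge a b).Reachable x y ↔ H.Reachable x y ∨
      (H.Reachable x a ∨ H.Reachable x b) ∧ (H.Reachable y a ∨ H.Reachable y b) := by
  constructor
  · rintro ⟨p⟩
    induction p with
    | nil => exact .inl .rfl
    | @cons x z y hxz _ ih =>
      rw [SimpleGraph.sup_adj, SimpleGraph.edge_adj] at hxz
      rcases hxz with hxz | ⟨⟨rfl, rfl⟩ | ⟨rfl, rfl⟩, -⟩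
      · exact ih.imp hxz.reachable.trans
          (And.imp_left (Or.imp hxz.reachable.trans hxz.reachable.trans))
      · exact .inr ⟨.inl .rfl, ih.elim (fun h ↦ .inr h.symm) And.right⟩
      · exact .inr ⟨.inr .rfl, ih.elim (fun h ↦ .inl h.symm) And.right⟩
  · have hab : (H ⊔ SimpleGraph.edge a b).Reachable a b := by
      by_cases hne : a = b
      · rw [hne]
      · exact SimpleGraph.Adj.reachable (by simp [SimpleGraph.edge_adj, hne])
    have hle {x y : V} (h : H.Reachable x y) : (H ⊔ SimpleGraph.edge a b).Reachable x y :=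
      h.mono le_sup_left
    have hend {x : V} (h : H.Reachable x a ∨ H.Reachable x b) :
        (H ⊔ SimpleGraph.edge a b).Reachable x a :=
      h.elim hle fun h ↦ (hle h).trans hab.symm
    rintro (h | ⟨hx, hy⟩)
    exacts [hle h, (hend hx).trans (hend hy).symm]

/-- `F` is a forest in which every tree contains exactly one element of `R`, its root. -/
structure IsRootedForest (R : Finset V) (F : SimpleGraph V) : Prop where
  isAcyclic : F.IsAcyclic
  exists_reachable : ∀ x, ∃ r ∈ R, F.Reachable x r
  eq_of_reachable : ∀ r ∈ R, ∀ s ∈ R, F.Reachable r s → r = s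

variable {R : Finset V} {F H : SimpleGraph V} {a b : V}

theorem IsRootedForest.of_sup_edge [DecidableEq V] (hb : b ∈ R) (hab : ¬ H.Adj a b) (hne : a ≠ b)
    (h : IsRootedForest R (H ⊔ SimpleGraph.edge a b)) : IsRootedForest (insert a R) H := by
  obtain ⟨hacyc, hbridge⟩ := SimpleGraph.isAcyclic_sup_fromEdgeSet_iff.1 h.isAcyclic
  have hsep : ¬ H.Reachable a b := fun hr ↦ (hbridge hr).elim hne hab
  have hroot : ∀ t ∈ R, ¬ H.Reachable a t := fun t ht hat ↦ by
    have hbt : (H ⊔ SimpleGraph.edge a b).Reachable b t :=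
      reachable_sup_edge_iff.2 (.inr ⟨.inr .rfl, .inl hat.symm⟩)
    exact hsep (h.eq_of_reachable b hb t ht hbt ▸ hat)
  refine ⟨hacyc, fun x ↦ ?_, fun r hr s hs hrs ↦ ?_⟩
  · obtain ⟨r, hr, hxr⟩ := h.exists_reachable x
    rcases reachable_sup_edge_iff.1 hxr with hxr | ⟨hxa | hxb, -⟩
    exacts [⟨r, Finset.mem_insert_of_mem hr, hxr⟩, ⟨a, Finset.mem_insert_self _ _, hxa⟩,
      ⟨b, Finset.mem_insert_of_mem hb, hxb⟩]
  · rcases Finset.mem_insert.1 hr with rfl | hr' <;> rcases Finset.mem_insert.1 hs with rfl | hs'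
    exacts [rfl, (hroot s hs' hrs).elim, (hroot r hr' hrs.symm).elim,
      h.eq_of_reachable r hr' s hs' (hrs.mono le_sup_left)]

theorem IsRootedForest.sup_edge [DecidableEq V] (ha : a ∉ R) (hb : b ∈ R)
    (h : IsRootedForest (insert a R) H) : IsRootedForest R (H ⊔ SimpleGraph.edge a b) := by
  have hroot : ∀ t ∈ R, ¬ H.Reachable a t := fun t ht hat ↦ ha <|
    h.eq_of_reachable a (Finset.mem_insert_self _ _) t (Finset.mem_insert_of_mem ht) hat ▸ ht
  refine ⟨h.isAcyclic.sup_edge_of_not_reachable (hroot b hb), fun x ↦ ?_, fun r hr s hs hrs ↦ ?_⟩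
  · obtain ⟨r, hr, hxr⟩ := h.exists_reachable x
    rcases Finset.mem_insert.1 hr with rfl | hr
    exacts [⟨b, hb, reachable_sup_edge_iff.2 (.inr ⟨.inl hxr, .inr .rfl⟩)⟩,
      ⟨r, hr, hxr.mono le_sup_left⟩]
  · refine h.eq_of_reachable r (Finset.mem_insert_of_mem hr) s (Finset.mem_insert_of_mem hs) ?_
    rcases reachable_sup_edge_iff.1 hrs with hrs | ⟨hra | hrb, hsa | hsb⟩
    exacts [hrs, (hroot r hr hra.symm).elim, (hroot r hr hra.symm).elim,
      (hroot s hs hsa.symm).elim, hrb.trans hsb.symm]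

theorem isRootedForest_singleton_iff {r : V} : IsRootedForest {r} F ↔ F.IsTree := by
  refine ⟨fun h ↦ ?_, fun h ↦ ?_⟩
  · have hr (x : V) : F.Reachable x r := by simpa using h.exists_reachable x
    exact ⟨(SimpleGraph.connected_iff_exists_forall_reachable F).2 ⟨r, fun x ↦ (hr x).symm⟩,
      h.isAcyclic⟩
  · exact ⟨h.isAcyclic, fun x ↦ ⟨r, by simp, h.connected.preconnected x r⟩, by simp⟩

theorem isRootedForest_pair_iff [DecidableEq V] {u v : V} (huv : u ≠ v) :
    IsRootedForest {u, v} F ↔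
      F.IsAcyclic ∧ Nat.card F.ConnectedComponent = 2 ∧ ¬ F.Reachable u v := by
  rw [Nat.card_eq_two_iff' (F.connectedComponentMk u)]
  refine ⟨fun h ↦ ?_, fun ⟨hacyc, hcard, hsep⟩ ↦ ⟨hacyc, fun x ↦ ?_, ?_⟩⟩
  · have hsep : ¬ F.Reachable u v := fun hr ↦ huv (h.eq_of_reachable u (by simp) v (by simp) hr)
    refine ⟨h.isAcyclic, ⟨F.connectedComponentMk v, ?_, fun c hc ↦ ?_⟩, hsep⟩
    · exact fun hvu ↦ hsep (SimpleGraph.ConnectedComponent.exact hvu).symm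
    · induction c using SimpleGraph.ConnectedComponent.ind with | _ x
      rw [ne_eq, SimpleGraph.ConnectedComponent.eq] at hc
      simpa [hc] using h.exists_reachable x
  · have hvu : F.connectedComponentMk v ≠ F.connectedComponentMk u :=
      fun hvu ↦ hsep (SimpleGraph.ConnectedComponent.exact hvu).symm
    by_cases hx : F.Reachable x u
    · exact ⟨u, by simp, hx⟩
    · have hxu : F.connectedComponentMk x ≠ F.connectedComponentMk u :=
        mt SimpleGraph.ConnectedComponent.exact hx
      exact ⟨v, by simp, SimpleGraph.ConnectedComponent.exact (hcard.unique hxu hvu)⟩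
  · simp [hsep, mt SimpleGraph.Reachable.symm hsep]

theorem isRootedForest_univ_iff [Fintype V] : IsRootedForest Finset.univ F ↔ F = ⊥ := by
  constructor
  · intro h
    refine eq_bot_iff.2 fun x y hxy ↦ hxy.ne ?_
    exact h.eq_of_reachable x (Finset.mem_univ x) y (Finset.mem_univ y) hxy.reachable
  · rintro rfl
    exact ⟨SimpleGraph.isAcyclic_bot, fun x ↦ ⟨x, Finset.mem_univ x, .rfl⟩,
      fun _ _ _ _ ↦ SimpleGraph.reachable_bot.1⟩

theorem IsRootedForest.exists_adj {x : V} (h : IsRootedForest R F) (hx : x ∉ R) :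
    ∃ a ∉ R, ∃ b ∈ R, F.Adj a b := by
  obtain ⟨r, hr, ⟨p⟩⟩ := h.exists_reachable x
  obtain ⟨d, -, hfst, hsnd⟩ := p.exists_boundary_dart (R : Set V)ᶜ hx (by simpa using hr)
  exact ⟨d.fst, hfst, d.snd, by simpa using hsnd, d.adj⟩

end RootedForests

section ForestWeights

variable {V : Type*} [Fintype V] {G H : SimpleGraph V} (w : Sym2 V → ℝ) {R : Finset V} {a b : V}

open Classical in
/-- The spanning forests of `G` in which every tree contains exactly one element of `R`.
They interpolate between `spanningTrees` (`R = {r}`) and `separatingForests` (`R = {u, v}`). -/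
noncomputable def rootedForests (G : SimpleGraph V) (R : Finset V) : Finset (SimpleGraph V) :=
  {F : SimpleGraph V | F ≤ G ∧ IsRootedForest R F}

theorem mem_rootedForests {F : SimpleGraph V} :
    F ∈ rootedForests G R ↔ F ≤ G ∧ IsRootedForest R F := by
  simp [rootedForests]

theorem mem_spanningTrees {T : SimpleGraph V} : T ∈ spanningTrees G ↔ T ≤ G ∧ T.IsTree := by
  simp [spanningTrees]

theorem rootedForests_singleton (r : V) : rootedForests G {r} = spanningTrees G := by
  ext F
  simp [mem_rootedForests, mem_spanningTrees, isRootedForest_singleton_iff]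

theorem rootedForests_pair [DecidableEq V] {u v : V} (huv : u ≠ v) :
    rootedForests G {u, v} = separatingForests G u v := by
  ext F
  simp [mem_rootedForests, separatingForests, isRootedForest_pair_iff huv]

theorem rootedForests_univ : rootedForests G Finset.univ = {⊥} := by
  ext F
  simp +contextual [mem_rootedForests, isRootedForest_univ_iff]

theorem rootedForests_eq_empty (hcut : ∀ a ∉ R, ∀ b ∈ R, ¬ G.Adj a b) {x : V} (hx : x ∉ R) :
    rootedForests G R = ∅ := by
  refine Finset.eq_empty_of_forall_notMem fun F hF ↦ ?_
  obtain ⟨hFG, hF⟩ := mem_rootedForests.1 hF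
  obtain ⟨a, ha, b, hb, hab⟩ := hF.exists_adj hx
  exact hcut a ha b hb (hFG hab)

theorem graphWeight_bot : graphWeight w ⊥ = 1 :=
  Finset.prod_eq_one fun e he ↦ by simp at he

theorem graphWeight_sup_edge (hne : a ≠ b) (hab : ¬ H.Adj a b) :
    graphWeight w (H ⊔ SimpleGraph.edge a b) = w s(a, b) * graphWeight w H := by
  classical
  rw [graphWeight, graphWeight, ← Finset.prod_insert (by simpa using hab)]
  congr! 1
  ext e
  simp [SimpleGraph.edgeSet_edge_of_ne hne, or_comm]

open Classical in
theorem filter_not_adj_rootedForests_sup_edge (hab : ¬ H.Adj a b) :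
    {F ∈ rootedForests (H ⊔ SimpleGraph.edge a b) R | ¬ F.Adj a b} = rootedForests H R := by
  ext F
  simp only [Finset.mem_filter, mem_rootedForests]
  refine ⟨fun ⟨⟨hF, hroot⟩, hFab⟩ ↦ ⟨?_, hroot⟩,
    fun ⟨hF, hroot⟩ ↦ ⟨⟨hF.trans le_sup_left, hroot⟩, fun h ↦ hab (hF h)⟩⟩
  rw [← SimpleGraph.sdiff_edge F hFab]
  exact sdiff_le_iff'.2 hF

open Classical in
theorem sum_graphWeight_filter_adj_rootedForests_sup_edge [DecidableEq V] (ha : a ∉ R) (hb : b ∈ R)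
    (hab : ¬ H.Adj a b) :
    ∑ F ∈ rootedForests (H ⊔ SimpleGraph.edge a b) R with F.Adj a b, graphWeight w F =
      w s(a, b) * familyWeight w (rootedForests H (insert a R)) := by
  have hne : a ≠ b := fun h ↦ ha (h ▸ hb)
  have hedge {F : SimpleGraph V} (hF : F.Adj a b) : F \ SimpleGraph.edge a b ⊔
      SimpleGraph.edge a b = F :=
    sdiff_sup_cancel (SimpleGraph.edge_le_iff F |>.2 (.inr hF))
  rw [familyWeight, Finset.mul_sum]
  refine (Finset.sum_nbij' (· ⊔ SimpleGraph.edge a b) (· \ SimpleGraph.edge a b)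
    (fun F hF ↦ ?_) (fun F hF ↦ ?_) (fun F hF ↦ ?_) (fun F hF ↦ ?_) (fun F hF ↦ ?_)).symm <;>
    simp only [Finset.mem_filter, mem_rootedForests] at hF ⊢
  · exact ⟨⟨sup_le_sup_right hF.1 _, hF.2.sup_edge ha hb⟩, by simp [SimpleGraph.edge_adj, hne]⟩
  · refine ⟨sdiff_le_iff'.2 hF.1.1, .of_sup_edge hb (by simp [SimpleGraph.edge_adj, hne]) hne ?_⟩
    rw [hedge hF.2]
    exact hF.1.2
  · rw [sup_sdiff_right_self, SimpleGraph.sdiff_edge F fun h ↦ hab (hF.1 h)]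
  · exact hedge hF.2
  · exact (graphWeight_sup_edge w hne fun h ↦ hab (hF.1 h)).symm

theorem familyWeight_rootedForests_sup_edge [DecidableEq V] (ha : a ∉ R) (hb : b ∈ R)
    (hab : ¬ H.Adj a b) :
    familyWeight w (rootedForests (H ⊔ SimpleGraph.edge a b) R) =
      familyWeight w (rootedForests H R) +
        w s(a, b) * familyWeight w (rootedForests H (insert a R)) := by
  classical
  rw [familyWeight, ← Finset.sum_filter_not_add_sum_filter _ (·.Adj a b),
    filter_not_adj_rootedForests_sup_edge hab,
    sum_graphWeight_filter_adj_rootedForests_sup_edge w ha hb hab]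
  rfl

end ForestWeights

section Minors

variable {m n K : Type*} [Fintype m] [DecidableEq m] [Fintype n] [DecidableEq n] [CommRing K]

/-- The minor of `A` obtained by deleting the rows and columns indexed by `R`. It is indexed by the
deleted set because for a Laplacian `R` becomes the set of roots of a forest. -/
def principalMinor (A : Matrix n n K) (R : Finset n) : K :=
  (A.submatrix (Subtype.val : {i // i ∉ R} → n) Subtype.val).det

theorem principalMinor_univ (A : Matrix n n K) : principalMinor A Finset.univ = 1 := by
  have : IsEmpty {i : n // i ∉ Finset.univ} := ⟨fun i ↦ i.2 (Finset.mem_univ _)⟩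
  exact det_isEmpty

theorem det_submatrix_eq_principalMinor {f : m → n} (hf : Function.Injective f) {R : Finset n}
    (hR : ∀ i, i ∈ Set.range f ↔ i ∉ R) (A : Matrix n n K) :
    (A.submatrix f f).det = principalMinor A R := by
  let e : m ≃ {i // i ∉ R} := (Equiv.ofInjective f hf).trans (Equiv.subtypeEquivRight hR)
  exact det_submatrix_equiv_self e (A.submatrix Subtype.val Subtype.val)

theorem det_add_single (A : Matrix n n K) (i j : n) (c : K) :
    (A + single i j c).det = A.det + c * A.adjugate j i := by
  have h : A + single i j c = A.updateRow i (A i + c • Pi.single j 1) := by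
    ext k l
    by_cases hk : k = i
    · subst hk
      simp [single_apply, Pi.single_apply, eq_comm]
    · simp [hk, Ne.symm hk]
  rw [h, det_updateRow_add, det_updateRow_smul, updateRow_eq_self, adjugate_apply]

theorem adjugate_apply_self (A : Matrix n n K) (i : n) :
    A.adjugate i i = (A.submatrix (Subtype.val : {j // j ≠ i} → n) Subtype.val).det := by
  rw [adjugate_apply, twoBlockTriangular_det _ (· ≠ i) (by simp +contextual)]
  have hcorner : (toSquareBlockProp (A.updateRow i (Pi.single i 1)) fun j ↦ ¬ j ≠ i).det = 1 := by
    have : Unique {j // ¬ j ≠ i} := ⟨⟨i, by simp⟩, fun j ↦ Subtype.ext (not_not.1 j.2)⟩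
    simp [det_unique, toSquareBlockProp_def, not_not.1 (default : {j // ¬ j ≠ i}).2]
  rw [hcorner, mul_one]
  congr 1
  ext j k
  simp [toSquareBlockProp_def, j.2]

theorem adjugate_submatrix_apply_self {f : m → n} (hf : Function.Injective f) {R : Finset n}
    (hR : ∀ i, i ∈ Set.range f ↔ i ∉ R) (A : Matrix n n K) (i : m) :
    (A.submatrix f f).adjugate i i = principalMinor A (insert (f i) R) := by
  rw [adjugate_apply_self, submatrix_submatrix]
  refine det_submatrix_eq_principalMinor (hf.comp Subtype.val_injective) (fun k ↦ ?_) A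
  rw [Finset.mem_insert, not_or, ← hR, Set.mem_range, Set.mem_range]
  constructor
  · rintro ⟨l, rfl⟩
    exact ⟨hf.ne l.2, l, rfl⟩
  · rintro ⟨hne, l, rfl⟩
    exact ⟨⟨l, ne_of_apply_ne f hne⟩, rfl⟩

end Minors

section GeneralizedInverse

variable {m n K : Type*} [Fintype m] [Fintype n]

theorem dotProduct_mulVec_eq_of_mul_mul_self [Semiring K] {A : Matrix m n K} {X Y : Matrix n m K}
    (hX : A * X * A = A) (hY : A * Y * A = A) {b : m → K} {c : n → K} (hb : ∃ x, A *ᵥ x = b)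
    (hc : ∃ y, y ᵥ* A = c) : c ⬝ᵥ X *ᵥ b = c ⬝ᵥ Y *ᵥ b := by
  obtain ⟨x, rfl⟩ := hb
  obtain ⟨y, rfl⟩ := hc
  have h (Z : Matrix n m K) (hZ : A * Z * A = A) : (y ᵥ* A) ⬝ᵥ Z *ᵥ A *ᵥ x = y ⬝ᵥ A *ᵥ x := by
    rw [← dotProduct_mulVec, mulVec_mulVec, mulVec_mulVec, hZ]
  rw [h X hX, h Y hY]

theorem eq_of_one_vecMul_eq {p : Type*} [Ring K] {M N : Matrix n p K} {r : n}
    (hsum : 1 ᵥ* M = 1 ᵥ* N) (hrow : ∀ i ≠ r, M i = N i) : M = N := by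
  classical
  refine funext fun i ↦ ?_
  by_cases hi : i = r
  · subst hi
    ext j
    have h := congrFun hsum j
    simp only [vecMul, one_dotProduct, Fintype.sum_eq_add_sum_subtype_ne _ i] at h
    rw [Finset.sum_congr rfl fun (k : {k // k ≠ i}) _ ↦ congrFun (hrow k k.2) j] at h
    exact add_right_cancel h
  · exact hrow i hi

variable [DecidableEq n]

theorem single_sub_single_dotProduct_mulVec [Ring K] (X : Matrix n n K) (u v : n) :
    (Pi.single u 1 - Pi.single v 1) ⬝ᵥ X *ᵥ (Pi.single u 1 - Pi.single v 1) =
      X u u + X v v - X u v - X v u := by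
  simp only [mulVec_sub, mulVec_single_one, sub_dotProduct, single_one_dotProduct, Pi.sub_apply,
    col_apply]
  abel

variable [CommRing K] {A : Matrix n n K} {r : n}

/-- The inverse of `A` with row and column `r` deleted, bordered by zeros at `r`: a generalized
inverse of `A` if the columns of `A` sum to zero and that inverse exists. -/
noncomputable def groundedInverse (A : Matrix n n K) (r : n) : Matrix n n K :=
  Matrix.of fun i j ↦ if h : i ≠ r ∧ j ≠ r then
    (A.submatrix Subtype.val Subtype.val : Matrix {k // k ≠ r} {k // k ≠ r} K)⁻¹
      ⟨i, h.1⟩ ⟨j, h.2⟩ else 0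

theorem groundedInverse_apply_left (A : Matrix n n K) (r j : n) : groundedInverse A r r j = 0 := by
  simp [groundedInverse]

theorem groundedInverse_apply_right (A : Matrix n n K) (r i : n) :
    groundedInverse A r i r = 0 := by
  simp [groundedInverse]

theorem groundedInverse_apply_of_ne (A : Matrix n n K) {i j : n} (hi : i ≠ r) (hj : j ≠ r) :
    groundedInverse A r i j =
      (A.submatrix Subtype.val Subtype.val : Matrix {k // k ≠ r} {k // k ≠ r} K)⁻¹
        ⟨i, hi⟩ ⟨j, hj⟩ := by
  simp [groundedInverse, hi, hj]

theorem mul_groundedInverse (hcol : 1 ᵥ* A = 0)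
    (hA : IsUnit (A.submatrix Subtype.val Subtype.val : Matrix {k // k ≠ r} {k // k ≠ r} K)) :
    A * groundedInverse A r = 1 - vecMulVec (Pi.single r 1) 1 := by
  refine eq_of_one_vecMul_eq (r := r) ?_ fun i hi ↦ funext fun j ↦ ?_
  · rw [← vecMul_vecMul, hcol, zero_vecMul, vecMul_sub, vecMul_one, vecMul_vecMulVec]
    simp
  · rw [mul_apply, Fintype.sum_eq_add_sum_subtype_ne _ r, groundedInverse_apply_left, mul_zero,
      zero_add]
    by_cases hj : j = r
    · simp [hj, hi, groundedInverse_apply_right]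
    · have h := congrFun₂ (mul_nonsing_inv _ ((isUnit_iff_isUnit_det _).1 hA)) ⟨i, hi⟩ ⟨j, hj⟩
      rw [Finset.sum_congr rfl fun (k : {k // k ≠ r}) _ ↦ by
        rw [groundedInverse_apply_of_ne A k.2 hj]]
      simpa [mul_apply, one_apply, hi, vecMulVec_apply] using h

theorem mul_groundedInverse_mul (hcol : 1 ᵥ* A = 0)
    (hA : IsUnit (A.submatrix Subtype.val Subtype.val : Matrix {k // k ≠ r} {k // k ≠ r} K)) :
    A * groundedInverse A r * A = A := by
  rw [mul_groundedInverse hcol hA, Matrix.sub_mul, vecMulVec_mul, hcol]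
  simp

end GeneralizedInverse

section Laplacian

variable {V : Type*} {G H : SimpleGraph V} {w : Sym2 V → ℝ} {R : Finset V} {a b : V}

open Classical in
/-- The adjacency matrix of `G` in which the edge `e` has the entry `w e`; the Laplacian is the
diagonal matrix of its row sums minus it. -/
noncomputable def weightedAdjMatrix (G : SimpleGraph V) (w : Sym2 V → ℝ) : Matrix V V ℝ :=
  .of fun i j ↦ if G.Adj i j then w s(i, j) else 0

theorem isSymm_weightedAdjMatrix (G : SimpleGraph V) (w : Sym2 V → ℝ) :
    (weightedAdjMatrix G w).IsSymm := by
  classical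
  ext i j
  exact if_congr (G.adj_comm j i) (by rw [Sym2.eq_swap]) rfl

theorem weightedAdjMatrix_sup_edge [DecidableEq V] (hne : a ≠ b) (hab : ¬ H.Adj a b) :
    weightedAdjMatrix (H ⊔ SimpleGraph.edge a b) w =
      weightedAdjMatrix H w + w s(a, b) • (single a b 1 + single b a 1) := by
  classical
  have hba : ¬ H.Adj b a := fun h ↦ hab h.symm
  ext i j
  by_cases h₁ : a = i ∧ b = j
  · obtain ⟨rfl, rfl⟩ := h₁
    simp [weightedAdjMatrix, SimpleGraph.edge_adj, hne, hab]
  by_cases h₂ : b = i ∧ a = j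
  · obtain ⟨rfl, rfl⟩ := h₂
    simp [weightedAdjMatrix, SimpleGraph.edge_adj, hne, hba, hne.symm, Sym2.eq_swap]
  have hadj : ¬ (SimpleGraph.edge a b).Adj i j := by
    rw [SimpleGraph.edge_adj]
    tauto
  simp [weightedAdjMatrix, hadj, h₁, h₂]

variable [Fintype V]

theorem laplacian_eq_diagonal_sub [DecidableEq V] (G : SimpleGraph V) (w : Sym2 V → ℝ) :
    laplacian G w = diagonal (weightedAdjMatrix G w *ᵥ 1) - weightedAdjMatrix G w := by
  ext i j
  rcases eq_or_ne i j with rfl | hij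
  · simp [laplacian, weightedAdjMatrix, mulVec, dotProduct]
  · simp [laplacian, weightedAdjMatrix, hij]

theorem isSymm_laplacian (G : SimpleGraph V) (w : Sym2 V → ℝ) : (laplacian G w).IsSymm := by
  classical
  rw [laplacian_eq_diagonal_sub]
  exact (isSymm_diagonal _).sub (isSymm_weightedAdjMatrix G w)

theorem laplacian_mulVec_one (G : SimpleGraph V) (w : Sym2 V → ℝ) : laplacian G w *ᵥ 1 = 0 := by
  classical
  rw [laplacian_eq_diagonal_sub, sub_mulVec, sub_eq_zero]
  ext i
  rw [mulVec_diagonal, Pi.one_apply, mul_one]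

theorem one_vecMul_laplacian (G : SimpleGraph V) (w : Sym2 V → ℝ) : 1 ᵥ* laplacian G w = 0 := by
  rw [← mulVec_transpose, isSymm_laplacian, laplacian_mulVec_one]

theorem laplacian_sup_edge [DecidableEq V] (hne : a ≠ b) (hab : ¬ H.Adj a b) :
    laplacian (H ⊔ SimpleGraph.edge a b) w = laplacian H w + w s(a, b) •
      vecMulVec (Pi.single a 1 - Pi.single b 1) (Pi.single a 1 - Pi.single b 1) := by
  have hadd (d e : V → ℝ) : diagonal (d + e) = diagonal d + diagonal e := (diagonal_add d e).symm
  have hrow (i j : V) : (single i j 1 : Matrix V V ℝ) *ᵥ 1 = Pi.single i 1 := by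
    rw [single_mulVec, Pi.one_apply, mul_one, Pi.single]
  have hedge : diagonal ((single a b 1 + single b a 1 : Matrix V V ℝ) *ᵥ 1) -
      (single a b 1 + single b a 1) =
        vecMulVec (Pi.single a 1 - Pi.single b 1) (Pi.single a 1 - Pi.single b 1) := by
    simp only [add_mulVec, hrow, hadd, diagonal_single, vecMulVec_sub, sub_vecMulVec,
      ← single_eq_single_vecMulVec_single]
    abel
  rw [laplacian_eq_diagonal_sub, laplacian_eq_diagonal_sub, weightedAdjMatrix_sup_edge hne hab,
    ← hedge, add_mulVec, smul_mulVec, hadd, diagonal_smul, smul_sub]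
  abel

theorem principalMinor_laplacian_sup_edge [DecidableEq V] (ha : a ∉ R) (hb : b ∈ R)
    (hab : ¬ H.Adj a b) :
    principalMinor (laplacian (H ⊔ SimpleGraph.edge a b) w) R =
      principalMinor (laplacian H w) R +
        w s(a, b) * principalMinor (laplacian H w) (insert a R) := by
  have hne : a ≠ b := fun h ↦ ha (h ▸ hb)
  have hsub : (laplacian (H ⊔ SimpleGraph.edge a b) w).submatrix
      (Subtype.val : {i // i ∉ R} → V) Subtype.val =
      (laplacian H w).submatrix Subtype.val Subtype.val +
        (single ⟨a, ha⟩ ⟨a, ha⟩ (w s(a, b)) : Matrix {i // i ∉ R} {i // i ∉ R} ℝ) := by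
    have hb' (i : {i // i ∉ R}) : i.1 ≠ b := fun h ↦ i.2 (h ▸ hb)
    ext i j
    simp [laplacian_sup_edge hne hab, vecMulVec_apply, Pi.single_apply, single_apply, hb',
      Subtype.ext_iff, ← ite_and, eq_comm, and_comm]
  rw [principalMinor, hsub, det_add_single,
    adjugate_submatrix_apply_self Subtype.val_injective (R := R) (by simp)]
  rfl

theorem principalMinor_laplacian_eq_zero [DecidableEq V] (hcut : ∀ a ∉ R, ∀ b ∈ R, ¬ G.Adj a b)
    {x : V} (hx : x ∉ R) : principalMinor (laplacian G w) R = 0 := by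
  refine exists_mulVec_eq_zero_iff.1 ⟨1, fun h ↦ one_ne_zero (congrFun h ⟨x, hx⟩), ?_⟩
  ext i
  have hzero : ∀ j ∈ R, laplacian G w i j = 0 := fun j hj ↦ by
    have hij : i.1 ≠ j := fun h ↦ i.2 (h ▸ hj)
    simp [laplacian, hij, hcut i i.2 j hj]
  have hrow := congrFun (laplacian_mulVec_one G w) i
  simp only [mulVec, dotProduct_one] at hrow ⊢
  rw [← Fintype.sum_subtype_add_sum_subtype (· ∉ R),
    Fintype.sum_eq_zero _ fun j : {j // ¬ j ∉ R} ↦ hzero j (not_not.1 j.2), add_zero] at hrow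
  exact hrow

theorem principalMinor_laplacian [DecidableEq V] (G : SimpleGraph V) (w : Sym2 V → ℝ)
    (R : Finset V) : principalMinor (laplacian G w) R = familyWeight w (rootedForests G R) := by
  induction G using WellFoundedLT.induction generalizing R with | _ G ih
  by_cases hR : R = Finset.univ
  · simp [hR, principalMinor_univ, rootedForests_univ, familyWeight, graphWeight_bot]
  obtain ⟨x, hx⟩ : ∃ x, x ∉ R := by simpa [Finset.eq_univ_iff_forall] using hR
  by_cases hcut : ∀ a ∉ R, ∀ b ∈ R, ¬ G.Adj a b
  · simp [principalMinor_laplacian_eq_zero hcut hx, rootedForests_eq_empty hcut hx, familyWeight]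
  · push Not at hcut
    obtain ⟨a, ha, b, hb, hab⟩ := hcut
    obtain ⟨H, hH, rfl⟩ : ∃ H : SimpleGraph V, ¬ H.Adj a b ∧ H ⊔ SimpleGraph.edge a b = G :=
      ⟨G \ SimpleGraph.edge a b, by simp [SimpleGraph.edge_adj, hab.ne],
        sdiff_sup_cancel (SimpleGraph.edge_le_iff G |>.2 (.inr hab))⟩
    have hlt : H < H ⊔ SimpleGraph.edge a b := H.lt_sup_edge a b hab.ne hH
    rw [principalMinor_laplacian_sup_edge ha hb hH, familyWeight_rootedForests_sup_edge w ha hb hH,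
      ih H hlt, ih H hlt]

end Laplacian

section Conclusion

variable {V : Type*} [Fintype V] {G : SimpleGraph V} {w : Sym2 V → ℝ} {u v : V}

theorem familyWeight_spanningTrees_pos (hw : ∀ e ∈ G.edgeSet, 0 ≤ w e)
    (hpos : (positivePart G w).Connected) : 0 < familyWeight w (spanningTrees G) := by
  classical
  obtain ⟨T, hT, hTree⟩ := hpos.exists_isTree_le
  have hedge : ∀ e ∈ T.edgeSet, e ∈ G.edgeSet ∧ 0 < w e := by
    have := SimpleGraph.edgeSet_mono hT
    rw [positivePart, SimpleGraph.edgeSet_fromEdgeSet] at this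
    exact fun e he ↦ (this he).1
  have hTG : T ≤ G := SimpleGraph.edgeSet_subset_edgeSet.1 fun e he ↦ (hedge e he).1
  refine Finset.sum_pos' (fun F hF ↦ Finset.prod_nonneg fun e he ↦ hw e ?_)
    ⟨T, mem_spanningTrees.2 ⟨hTG, hTree⟩, Finset.prod_pos fun e he ↦ ?_⟩
  · exact SimpleGraph.edgeSet_mono (mem_spanningTrees.1 hF).1 (SimpleGraph.mem_edgeFinset.1 he)
  · exact (hedge e (SimpleGraph.mem_edgeFinset.1 he)).2

theorem separatingForests_comm (G : SimpleGraph V) (u v : V) :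
    separatingForests G u v = separatingForests G v u := by
  classical
  exact Finset.filter_congr fun F _ ↦ by rw [SimpleGraph.reachable_comm]

theorem familyWeight_separatingForests_self (G : SimpleGraph V) (w : Sym2 V → ℝ) (u : V) :
    familyWeight w (separatingForests G u u) = 0 := by
  simp [familyWeight, separatingForests]

theorem isSymm_pseudoInverse {n : Type*} [Fintype n] {A : Matrix n n ℝ} (hA : A.IsSymm) :
    (pseudoInverse A).IsSymm := by
  have h := (pseudoInverse_spec A).transpose
  rw [hA] at h
  exact h.unique (pseudoInverse_spec A)

theorem det_reducedLaplacian [DecidableEq V] (G : SimpleGraph V) (w : Sym2 V → ℝ) (r : V) :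
    (reducedLaplacian G w r).det = familyWeight w (spanningTrees G) := by
  rw [reducedLaplacian, det_submatrix_eq_principalMinor Subtype.val_injective (R := {r}) (by simp),
    principalMinor_laplacian, rootedForests_singleton]

theorem isUnit_reducedLaplacian [DecidableEq V] (hT : familyWeight w (spanningTrees G) ≠ 0)
    (r : V) : IsUnit (reducedLaplacian G w r) := by
  rwa [isUnit_iff_isUnit_det, det_reducedLaplacian, isUnit_iff_ne_zero]

theorem groundedInverse_laplacian_apply [DecidableEq V] {r : V} (hu : u ≠ r) (hv : v ≠ r) :
    groundedInverse (laplacian G w) r u v = (reducedLaplacian G w r)⁻¹ ⟨u, hu⟩ ⟨v, hv⟩ :=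
  groundedInverse_apply_of_ne _ hu hv

theorem isSymm_inv_reducedLaplacian [DecidableEq V] (G : SimpleGraph V) (w : Sym2 V → ℝ)
    (r : V) : (reducedLaplacian G w r)⁻¹.IsSymm :=
  ((isSymm_laplacian G w).submatrix _).inv

theorem familyWeight_separatingForests_eq_inv_reducedLaplacian [DecidableEq V]
    (hT : familyWeight w (spanningTrees G) ≠ 0) (huv : u ≠ v) :
    familyWeight w (separatingForests G u v) =
      familyWeight w (spanningTrees G) * (reducedLaplacian G w v)⁻¹ ⟨u, huv⟩ ⟨u, huv⟩ := by
  have hadj : (reducedLaplacian G w v).adjugate ⟨u, huv⟩ ⟨u, huv⟩ =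
      familyWeight w (separatingForests G u v) := by
    rw [reducedLaplacian, adjugate_submatrix_apply_self Subtype.val_injective (R := {v}) (by simp),
      principalMinor_laplacian, rootedForests_pair huv]
  rw [inv_def, Matrix.smul_apply, smul_eq_mul, det_reducedLaplacian, hadj, Ring.inverse_eq_inv',
    mul_inv_cancel_left₀ hT]

theorem exists_laplacian_mulVec_eq [DecidableEq V] (hT : familyWeight w (spanningTrees G) ≠ 0)
    (u v : V) : ∃ x, laplacian G w *ᵥ x = Pi.single u 1 - Pi.single v 1 := by
  have hinv := mul_groundedInverse (one_vecMul_laplacian G w) (isUnit_reducedLaplacian hT v)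
  refine ⟨(groundedInverse (laplacian G w) v).col u, ?_⟩
  rw [← mulVec_single_one, mulVec_mulVec, hinv, sub_mulVec, one_mulVec, vecMulVec_mulVec]
  simp

theorem familyWeight_separatingForests_eq_of_mul_mul_self
    (hT : familyWeight w (spanningTrees G) ≠ 0) {X : Matrix V V ℝ}
    (hX : laplacian G w * X * laplacian G w = laplacian G w) (u v : V) :
    familyWeight w (separatingForests G u v) =
      familyWeight w (spanningTrees G) * (X u u + X v v - X u v - X v u) := by
  classical
  rcases eq_or_ne u v with rfl | huv
  · simp [familyWeight_separatingForests_self]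
  have hrange := exists_laplacian_mulVec_eq hT u v
  have hrange' := hrange
  simp_rw [← vecMul_transpose, (isSymm_laplacian G w).eq] at hrange'
  have hinv := mul_groundedInverse_mul (one_vecMul_laplacian G w) (isUnit_reducedLaplacian hT v)
  have h := dotProduct_mulVec_eq_of_mul_mul_self hX hinv hrange hrange'
  rw [single_sub_single_dotProduct_mulVec, single_sub_single_dotProduct_mulVec,
    groundedInverse_apply_left, groundedInverse_apply_left, groundedInverse_apply_right,
    groundedInverse_laplacian_apply huv huv] at h
  rw [h, familyWeight_separatingForests_eq_inv_reducedLaplacian hT huv]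
  simp

end Conclusion

end WeightedGraph

open WeightedGraph in
theorem lemma2p2_general {V : Type*} [Fintype V] [DecidableEq V] (G : SimpleGraph V)
    (w : Sym2 V → ℝ) (hT : familyWeight w (spanningTrees G) ≠ 0) (u v : V) :
    familyWeight w (separatingForests G u v) =
        familyWeight w (spanningTrees G) *
          (pseudoInverse (laplacian G w) u u + pseudoInverse (laplacian G w) v v
            - 2 * pseudoInverse (laplacian G w) u v) ∧
    (∀ r : V, IsUnit (reducedLaplacian G w r)) ∧
    (∀ (r : V) (hu : u ≠ r) (hv : v ≠ r),
      familyWeight w (separatingForests G u v) =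
        familyWeight w (spanningTrees G) *
          ((reducedLaplacian G w r)⁻¹ ⟨u, hu⟩ ⟨u, hu⟩
            + (reducedLaplacian G w r)⁻¹ ⟨v, hv⟩ ⟨v, hv⟩
            - 2 * (reducedLaplacian G w r)⁻¹ ⟨u, hu⟩ ⟨v, hv⟩)) ∧
    (∀ huv : u ≠ v,
      familyWeight w (separatingForests G u v) =
        familyWeight w (spanningTrees G) *
          (reducedLaplacian G w v)⁻¹ ⟨u, huv⟩ ⟨u, huv⟩) ∧
    (∀ huv : u ≠ v,
      familyWeight w (separatingForests G u v) =
        familyWeight w (spanningTrees G) *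
          (reducedLaplacian G w u)⁻¹ ⟨v, huv.symm⟩ ⟨v, huv.symm⟩) := by
  refine ⟨?_, isUnit_reducedLaplacian hT, fun r hu hv ↦ ?_, fun huv ↦ ?_, fun huv ↦ ?_⟩
  · rw [familyWeight_separatingForests_eq_of_mul_mul_self hT
        (pseudoInverse_spec (laplacian G w)).mul_mul_self,
      (isSymm_pseudoInverse (isSymm_laplacian G w)).apply u v]
    ring
  · have hX := mul_groundedInverse_mul (one_vecMul_laplacian G w) (isUnit_reducedLaplacian hT r)
    rw [familyWeight_separatingForests_eq_of_mul_mul_self hT hX,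
      groundedInverse_laplacian_apply hu hu, groundedInverse_laplacian_apply hv hv,
      groundedInverse_laplacian_apply hu hv, groundedInverse_laplacian_apply hv hu,
      (isSymm_inv_reducedLaplacian G w r).apply ⟨u, hu⟩ ⟨v, hv⟩]
    ring
  · exact familyWeight_separatingForests_eq_inv_reducedLaplacian hT huv
  · rw [separatingForests_comm]
    exact familyWeight_separatingForests_eq_inv_reducedLaplacian hT huv.symm

open WeightedGraph in
theorem lemma2p2 {V : Type*} [Fintype V] [DecidableEq V] (G : SimpleGraph V)
    (w : Sym2 V → ℝ) (hw : ∀ e ∈ G.edgeSet, 0 ≤ w e)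
    (hG : G.Connected) (hpos : (positivePart G w).Connected) (u v : V) :
    familyWeight w (separatingForests G u v) =
        familyWeight w (spanningTrees G) *
          (pseudoInverse (laplacian G w) u u + pseudoInverse (laplacian G w) v v
            - 2 * pseudoInverse (laplacian G w) u v) ∧
    (∀ r : V, IsUnit (reducedLaplacian G w r)) ∧
    (∀ (r : V) (hu : u ≠ r) (hv : v ≠ r),
      familyWeight w (separatingForests G u v) =
        familyWeight w (spanningTrees G) *
          ((reducedLaplacian G w r)⁻¹ ⟨u, hu⟩ ⟨u, hu⟩
            + (reducedLaplacian G w r)⁻¹ ⟨v, hv⟩ ⟨v, hv⟩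
            - 2 * (reducedLaplacian G w r)⁻¹ ⟨u, hu⟩ ⟨v, hv⟩)) ∧
    (∀ huv : u ≠ v,
      familyWeight w (separatingForests G u v) =
        familyWeight w (spanningTrees G) *
          (reducedLaplacian G w v)⁻¹ ⟨u, huv⟩ ⟨u, huv⟩) ∧
    (∀ huv : u ≠ v,
      familyWeight w (separatingForests G u v) =
        familyWeight w (spanningTrees G) *
          (reducedLaplacian G w u)⁻¹ ⟨v, huv.symm⟩ ⟨v, huv.symm⟩) :=
  lemma2p2_general G w (familyWeight_spanningTrees_pos hw hpos).ne' u v
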